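/- Let $F$ be a field with $\operatorname{char}(F)\neq 2,3$, and let $K/F$ be a quadratic étale extension (an étale $F$-algebra of dimension $2$; $K=F\times F$ is allowed) with non-trivial $F$-automorphism $\sigma$, written $t\mapsto t^\sigma$. A \emph{cubic norm structure} $\mathcal J=(J,N,\sharp,T,1)$ over $K$ consists of a $K$-module $J$, a map $N\colon J\to K$, a quadratic map $\sharp\colon J\to J$ (that is, $(ta)^\sharp=t^2a^\sharp$ and $a\times b:=(a+b)^\sharp-a^\sharp-b^\sharp$ is $K$-bilinear), a symmetric $K$-bilinear form $T\colon J\times J\to K$ and an element $1\in J\setminus\{0\}$ such that for all $t\in K$ and $a,b\in J$: $N(ta)=t^3N(a)$; $N(a+b)=N(a)+T(b,a^\sharp)+T(a,b^\sharp)+N(b)$; $a^{\sharp\sharp}=N(a)a$; $1^\sharp=1$; and $b=T(b,1)1-1\times b$. Put $U_a(b):=T(a,b)a-a^\sharp\times b$, and call $a$ \emph{invertible} if $N(a)$ is invertible in $K$. A \emph{$\sigma$-semilinear autotopy} of $\mathcal J$ is an additive bijection $\varphi\colon J\to J$ with $\varphi(ta)=t^\sigma\varphi(a)$ such that $z:=\varphi(1)$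 is invertible and $\varphi(a^\sharp)=N(z)^{-1}U_z(\varphi(a)^\sharp)$ for all $a\in J$; it is \emph{self-adjoint} if $\varphi^{-1}U_z=\varphi$. Let $\mathcal J=(J,N,\sharp,T,1)$ be a cubic norm structure over $K$, let $\varphi$ be a $\sigma$-semilinear self-adjoint autotopy of $\mathcal J$, let $\delta:=N(\varphi(1))$, and assume that $\gamma\in K$ satisfies $\gamma\gamma^\sigma=\delta^{-1}$. Then $\delta\in F$. Let $\mathcal A=K\oplus J$ as an $F$-vector space, with \[ \overline{(s,b)}:=(s^\sigma,b),\qquad (s,b)(t,c):=\bigl(st+T(b,\varphi(c)),\; sc+t^\sigma b+\gamma\,(\varphi(b)\times\varphi(c))\bigr) \] for $s,t\in K$ and $b,c\in J$. Then $\mathcal A$ is a \emph{structurable $F$-algebra}: it is a unital (not necessarily associative or commutative) $F$-algebra with identity $(1,0)$, the map $x\mapsto\overline{x}$ is an $F$-linear involution ($\overline{\overline x}=x$, $\overline{xy}=\overline y\,\overline x$), and, with $V_{x,y}(z):=(x\overline y)z+(z\overline y)x-(z\overline x)y$, \[ [V_{x,y},V_{z,w}]=V_{V_{x,y}(z),w}-V_{z,V_{y,x}(w)}\qquad\text{for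 all }x,y,z,w\in\mathcal A. \] Moreover $\mathcal A$ has \emph{skew-dimension one}: $\dim_F\{x\in\mathcal A:\overline x=-x\}=1$. If $T$ is non-degenerate, then $\mathcal A$ is \emph{central} (every $x$ with $\overline x=x$ that commutes with all elements of $\mathcal{A}$ and associates with all pairs of elements of $\mathcal{A}$, in every position, lies in $F\cdot 1$) and \emph{simple} ($\mathcal A\neq 0$, and its only two-sided ideals $I$, meaning $F$-subspaces with $I\mathcal A\subseteq I$ and $\mathcal AI\subseteq I$, with $\overline I=I$ are $0$ and $\mathcal A$). -/

import Mathlib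

/-- A cubic norm structure `(J, N, ♯, T, 1)` over a commutative ring `K` (in the setting where `6` is
invertible in `K`), on the `K`-module `J`.
The adjoint `♯` is a quadratic map, i.e. `(t a)^♯ = t² a^♯` and the map
`a × b := (a + b)^♯ - a^♯ - b^♯ = QuadraticMap.polar ♯ a b` is `K`-bilinear. -/
structure CubicNormStructure (K J : Type*) [CommRing K] [AddCommGroup J] [Module K J] where
  /-- the norm -/
  N : J → K
  /-- the adjoint -/
  sharp : QuadraticMap K J J
  /-- the trace -/
  T : LinearMap.BilinForm K J
  /-- the identity -/
  one : J
  T_symm : ∀ a b, T a b = T b a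
  one_ne_zero : one ≠ 0
  N_smul : ∀ (t : K) (a : J), N (t • a) = t ^ 3 * N a
  N_add : ∀ a b, N (a + b) = N a + T b (sharp a) + T a (sharp b) + N b
  sharp_sharp : ∀ a, sharp (sharp a) = N a • a
  sharp_one : sharp one = one
  eq_trace_smul_one_sub : ∀ b, b = T b one • one - QuadraticMap.polar sharp one b

namespace CubicNormStructure

variable {K J : Type*} [CommRing K] [AddCommGroup J] [Module K J] (𝒥 : CubicNormStructure K J)

/-- `a × b = (a + b)^♯ - a^♯ - b^♯`. -/
def cross (a b : J) : J := 𝒥.sharp (a + b) - 𝒥.sharp a - 𝒥.sharp b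

/-- The `U`-operators `U_a(b) = T(a, b) a - a^♯ × b`. -/
def U (a b : J) : J := 𝒥.T a b • a - 𝒥.cross (𝒥.sharp a) b

/-- An element is invertible if its norm is invertible in `K`. -/
def IsInvertible (a : J) : Prop := IsUnit (𝒥.N a)

/-- The adjoint map of the `z`-isotope: `a^{♯_z} = N(z)⁻¹ U_z(a^♯)` (for invertible `z`). -/
noncomputable def isotopeSharp (z a : J) : J := Ring.inverse (𝒥.N z) • 𝒥.U z (𝒥.sharp a)

/-- The `σ`-semilinear autotopies of a cubic norm structure: the `σ`-semilinear bijections `φ` such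
that `z := φ(1)` is invertible and `φ(a^♯) = φ(a)^{♯_z}` for all `a`. -/
structure Autotopy (σ : K ≃+* K) extends J ≃+ J where
  map_smul' : ∀ (t : K) (a : J), toFun (t • a) = σ t • toFun a
  isInvertible_map_one' : 𝒥.IsInvertible (toFun 𝒥.one)
  map_sharp' : ∀ a : J, toFun (𝒥.sharp a) = 𝒥.isotopeSharp (toFun 𝒥.one) (toFun a)

variable {𝒥} {σ : K ≃+* K}

instance : CoeFun (Autotopy 𝒥 σ) (fun _ => J → J) := ⟨fun φ => φ.toAddEquiv⟩

/-- The adjoint `φ̌ = φ⁻¹ U_{φ(1)}` of an autotopy `φ`. -/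
def Autotopy.adjoint (φ : Autotopy 𝒥 σ) : J → J :=
  fun a => φ.toAddEquiv.symm (𝒥.U (φ 𝒥.one) a)

/-- An autotopy is self-adjoint if it is equal to its adjoint. -/
def Autotopy.IsSelfAdjoint (φ : Autotopy 𝒥 σ) : Prop := φ.adjoint = φ

lemma cross_eq_polarBilin (a b : J) : 𝒥.cross a b = 𝒥.sharp.polarBilin a b := rfl

lemma cross_smul_left (t : K) (a b : J) : 𝒥.cross (t • a) b = t • 𝒥.cross a b := by
  rw [cross_eq_polarBilin, cross_eq_polarBilin, map_smul, LinearMap.smul_apply]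

lemma cross_smul_right (t : K) (a b : J) : 𝒥.cross a (t • b) = t • 𝒥.cross a b := by
  rw [cross_eq_polarBilin, cross_eq_polarBilin, map_smul]

lemma Autotopy.map_add (φ : Autotopy 𝒥 σ) (a b : J) : φ (a + b) = φ a + φ b :=
  φ.toAddEquiv.map_add a b

lemma Autotopy.map_zero (φ : Autotopy 𝒥 σ) : φ 0 = 0 := φ.toAddEquiv.map_zero

lemma Autotopy.map_smul (φ : Autotopy 𝒥 σ) (t : K) (a : J) : φ (t • a) = σ t • φ a :=
  φ.map_smul' t a

end CubicNormStructure

/-! ### Algebras with involution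

In this section `A` is a unital, not necessarily associative or commutative `F`-algebra, and `bar` is
an `F`-linear map from `A` to itself. -/

section AlgebrasWithInvolution

variable {F A : Type*} [Field F] [NonAssocRing A] [Module F A] [SMulCommClass F A A]
  [IsScalarTower F A A]

/-- `V_{x,y}(z) = (x ȳ) z + (z ȳ) x - (z x̄) y`, as an endomorphism of `A`. -/
def structurableV (bar : A →ₗ[F] A) (x y : A) : Module.End F A where
  toFun z := (x * bar y) * z + (z * bar y) * x - (z * bar x) * y
  map_add' z w := by simp only [mul_add, add_mul]; abel
  map_smul' r z := by
    simp only [mul_smul_comm, smul_mul_assoc, smul_add, smul_sub, RingHom.id_apply]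

/-- `(A, bar)` is a structurable algebra over `F`: `bar` is an involution (an `F`-linear
anti-automorphism of period two) and
`[V_{x,y}, V_{z,w}] = V_{V_{x,y}(z),w} - V_{z,V_{y,x}(w)}` for all `x, y, z, w`. -/
structure IsStructurable (bar : A →ₗ[F] A) : Prop where
  bar_bar : ∀ x, bar (bar x) = x
  bar_mul : ∀ x y, bar (x * y) = bar y * bar x
  bracket_V : ∀ x y z w : A,
    ⁅structurableV bar x y, structurableV bar z w⁆ =
      structurableV bar (structurableV bar x y z) w - structurableV bar z (structurableV bar y x w)

/-- The space `S` of skew elements of `(A, bar)`. -/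
def skewElements (bar : A →ₗ[F] A) : Submodule F A where
  carrier := {x | bar x = -x}
  add_mem' {x y} hx hy := by
    simp only [Set.mem_ofPred_eq] at hx hy ⊢
    rw [map_add, hx, hy, neg_add]
  zero_mem' := by simp
  smul_mem' r x hx := by
    simp only [Set.mem_ofPred_eq] at hx ⊢
    rw [map_smul, hx, smul_neg]

/-- The center of `(A, bar)`: the hermitian elements that commute and associate with everything. -/
def involutionCenter (bar : A →ₗ[F] A) : Set A :=
  {x | bar x = x ∧ (∀ y, x * y - y * x = 0) ∧ (∀ y z, associator x y z = 0) ∧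
    (∀ y z, associator y x z = 0) ∧ ∀ y z, associator y z x = 0}

/-- `(A, bar)` is central over `F` if its center is `F · 1`. -/
def IsCentralWithInvolution (bar : A →ₗ[F] A) : Prop :=
  involutionCenter bar = Set.range fun r : F => r • (1 : A)

/-- The ideals of `(A, bar)`: the two-sided ideals that are stable under the involution. -/
def IsInvolutionIdeal (bar : A →ₗ[F] A) (I : Submodule F A) : Prop :=
  (∀ x ∈ I, ∀ y, x * y ∈ I) ∧ (∀ x ∈ I, ∀ y, y * x ∈ I) ∧ I.map bar = I

/-- `(A, bar)` is simple if it is non-zero and has no proper non-trivial ideals. -/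
def IsSimpleWithInvolution (bar : A →ₗ[F] A) : Prop :=
  Nontrivial A ∧ ∀ I : Submodule F A, IsInvolutionIdeal bar I → I = ⊥ ∨ I = ⊤

end AlgebrasWithInvolution

/-! ### The construction -/

section Construction

variable {F K J : Type*} [Field F] [CommRing K] [Algebra F K] [AddCommGroup J] [Module K J]
  {𝒥 : CubicNormStructure K J} {σ : K ≃ₐ[F] K}

/-- The elements `(s, b)` of the `F`-vector space `K ⊕ J`, to be equipped with the multiplication
determined by `φ` and `γ`. -/
@[ext]
structure AutotopyAlgebra (φ : 𝒥.Autotopy σ.toRingEquiv) (γ : K) where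
  /-- the component in `K` -/
  fst : K
  /-- the component in `J` -/
  snd : J

namespace AutotopyAlgebra

variable {φ : 𝒥.Autotopy σ.toRingEquiv} {γ : K}

instance : Zero (AutotopyAlgebra φ γ) := ⟨⟨0, 0⟩⟩

instance : Add (AutotopyAlgebra φ γ) := ⟨fun x y => ⟨x.fst + y.fst, x.snd + y.snd⟩⟩

instance : Neg (AutotopyAlgebra φ γ) := ⟨fun x => ⟨-x.fst, -x.snd⟩⟩

instance : Sub (AutotopyAlgebra φ γ) := ⟨fun x y => ⟨x.fst - y.fst, x.snd - y.snd⟩⟩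

instance {R : Type*} [SMul R K] [SMul R J] : SMul R (AutotopyAlgebra φ γ) :=
  ⟨fun r x => ⟨r • x.fst, r • x.snd⟩⟩

/-- `1 = (1, 0)`. -/
instance : One (AutotopyAlgebra φ γ) := ⟨⟨1, 0⟩⟩

/-- `(s, b) (t, c) = (s t + T(b, φ(c)), s c + t^σ b + γ (φ(b) × φ(c)))`. -/
instance : Mul (AutotopyAlgebra φ γ) :=
  ⟨fun x y => ⟨x.fst * y.fst + 𝒥.T x.snd (φ y.snd),
    x.fst • y.snd + σ y.fst • x.snd + γ • 𝒥.cross (φ x.snd) (φ y.snd)⟩⟩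

lemma fst_zero : (0 : AutotopyAlgebra φ γ).fst = 0 := rfl

lemma snd_zero : (0 : AutotopyAlgebra φ γ).snd = 0 := rfl

lemma fst_add (x y : AutotopyAlgebra φ γ) : (x + y).fst = x.fst + y.fst := rfl

lemma snd_add (x y : AutotopyAlgebra φ γ) : (x + y).snd = x.snd + y.snd := rfl

lemma fst_one : (1 : AutotopyAlgebra φ γ).fst = 1 := rfl

lemma snd_one : (1 : AutotopyAlgebra φ γ).snd = 0 := rfl

lemma fst_smul {R : Type*} [SMul R K] [SMul R J] (r : R) (x : AutotopyAlgebra φ γ) :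
    (r • x).fst = r • x.fst := rfl

lemma snd_smul {R : Type*} [SMul R K] [SMul R J] (r : R) (x : AutotopyAlgebra φ γ) :
    (r • x).snd = r • x.snd := rfl

lemma fst_mul (x y : AutotopyAlgebra φ γ) :
    (x * y).fst = x.fst * y.fst + 𝒥.T x.snd (φ y.snd) := rfl

lemma snd_mul (x y : AutotopyAlgebra φ γ) :
    (x * y).snd = x.fst • y.snd + σ y.fst • x.snd + γ • 𝒥.cross (φ x.snd) (φ y.snd) := rfl

lemma toProd_injective :
    Function.Injective (fun x : AutotopyAlgebra φ γ => ((x.fst, x.snd) : K × J)) :=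
  fun _ _ h => AutotopyAlgebra.ext (congrArg Prod.fst h) (congrArg Prod.snd h)

instance : AddCommGroup (AutotopyAlgebra φ γ) :=
  toProd_injective.addCommGroup _ rfl (fun _ _ => rfl) (fun _ => rfl) (fun _ _ => rfl)
    (fun _ _ => rfl) (fun _ _ => rfl)

instance [Module F J] : Module F (AutotopyAlgebra φ γ) :=
  toProd_injective.module F
    { toFun := fun x : AutotopyAlgebra φ γ => ((x.fst, x.snd) : K × J)
      map_zero' := rfl
      map_add' := fun _ _ => rfl } (fun _ _ => rfl)

instance : NonAssocRing (AutotopyAlgebra φ γ) :=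
  { (inferInstance : AddCommGroup (AutotopyAlgebra φ γ)),
    (inferInstance : One (AutotopyAlgebra φ γ)),
    (inferInstance : Mul (AutotopyAlgebra φ γ)) with
    left_distrib := fun x y z => by
      apply AutotopyAlgebra.ext
      · simp only [fst_mul, fst_add, snd_add, φ.map_add, map_add]; ring
      · simp only [snd_mul, fst_add, snd_add, φ.map_add, map_add, add_smul, smul_add,
          CubicNormStructure.cross_eq_polarBilin]
        abel
    right_distrib := fun x y z => by
      apply AutotopyAlgebra.ext
      · simp only [fst_mul, fst_add, snd_add, map_add, LinearMap.add_apply]; ring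
      · simp only [snd_mul, fst_add, snd_add, φ.map_add, map_add, add_smul, smul_add,
          CubicNormStructure.cross_eq_polarBilin, LinearMap.add_apply]
        abel
    zero_mul := fun x => by
      apply AutotopyAlgebra.ext <;>
      simp [fst_mul, snd_mul, fst_zero, snd_zero, φ.map_zero,
        CubicNormStructure.cross_eq_polarBilin]
    mul_zero := fun x => by
      apply AutotopyAlgebra.ext <;>
      simp [fst_mul, snd_mul, fst_zero, snd_zero, φ.map_zero,
        CubicNormStructure.cross_eq_polarBilin]
    one_mul := fun x => by
      apply AutotopyAlgebra.ext <;>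
      simp [fst_mul, snd_mul, fst_one, snd_one, φ.map_zero,
        CubicNormStructure.cross_eq_polarBilin]
    mul_one := fun x => by
      apply AutotopyAlgebra.ext <;>
      simp [fst_mul, snd_mul, fst_one, snd_one, φ.map_zero,
        CubicNormStructure.cross_eq_polarBilin] }

lemma autotopy_map_base_smul [Module F J] [IsScalarTower F K J] (r : F) (b : J) :
    φ (r • b) = r • φ b := by
  rw [← algebraMap_smul K r b, ← algebraMap_smul K r (φ b), φ.map_smul]
  congr 1
  exact σ.commutes r

instance [Module F J] [IsScalarTower F K J] :
    IsScalarTower F (AutotopyAlgebra φ γ) (AutotopyAlgebra φ γ) := ⟨fun r x y => by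
  apply AutotopyAlgebra.ext
  · simp only [smul_eq_mul, fst_mul, fst_smul, snd_smul, ← algebraMap_smul K r x.snd, map_smul,
      LinearMap.smul_apply, Algebra.smul_def]
    ring
  · simp only [smul_eq_mul, snd_mul, fst_smul, snd_smul, autotopy_map_base_smul]
    rw [← algebraMap_smul K r x.snd, ← algebraMap_smul K r (φ x.snd),
      CubicNormStructure.cross_smul_left, ← algebraMap_smul K r (_ + _), Algebra.smul_def]
    module⟩

instance [Module F J] [IsScalarTower F K J] :
    SMulCommClass F (AutotopyAlgebra φ γ) (AutotopyAlgebra φ γ) := ⟨fun r x y => by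
  apply AutotopyAlgebra.ext
  · simp only [smul_eq_mul, fst_mul, fst_smul, snd_smul, autotopy_map_base_smul,
      ← algebraMap_smul K r (φ y.snd), map_smul, Algebra.smul_def]
    ring
  · simp only [smul_eq_mul, snd_mul, fst_smul, snd_smul, autotopy_map_base_smul]
    rw [← algebraMap_smul K r y.snd, ← algebraMap_smul K r (φ y.snd),
      CubicNormStructure.cross_smul_right, ← algebraMap_smul K r (_ + _), Algebra.smul_def,
      map_mul, AlgEquiv.commutes]
    module⟩

variable (φ γ)

/-- The involution `(s, b) ↦ (s^σ, b)`. -/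
def bar [Module F J] : AutotopyAlgebra φ γ →ₗ[F] AutotopyAlgebra φ γ where
  toFun x := ⟨σ x.fst, x.snd⟩
  map_add' x y := AutotopyAlgebra.ext (map_add σ x.fst y.fst) rfl
  map_smul' r x := AutotopyAlgebra.ext (map_smul σ r x.fst) rfl

end AutotopyAlgebra

end Construction

/-!
The proof passes from `(𝒥, φ, γ)` to the hermitian form `h(a, b) = T(a, φ(b))` and the
`σ`-semilinear product `a ∗ b = γ (φ(a) × φ(b))` on `J`, in terms of which
`(s, b) (t, c) = (s t + h(b, c), s c + t^σ b + b ∗ c)`.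

Self-adjointness says that `φ² = U_z` with `z = φ(1)`, and the autotopy law becomes
`φ(φ(a)^♯) = δ^σ a^♯` with `δ = N(z)`. Iterating it compares `N(φ(a))` with `N(a)^σ`: one obtains
first `δ^σ = δ` and then `N(φ(a)) = δ N(a)^σ`, and linearizing this shows that `h` is hermitian,
because the elements `a^♯` span `J`. The two adjoint identities
`a^♯ × (a × b) = N(a) b + T(a^♯, b) a` and `a × (a^♯ × b) = N(a) b + T(a, b) a^♯` hold in `𝒥` in
fully linearized form (`cross_cross_sum` and `cross_cross_cross_sum`) and are inherited by `h` and
`∗` (`IsHermitianCubic`).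

The structurable identity says that `V_{x,y}` and `-V_{y,x}` form a derivation pair of the triple
product `{x, y, z} = V_{x,y}(z)`. As derivation pairs are closed under differences and commutators,
it suffices to treat `V_{a,1}` and `-V_{ā,1}` (`IsStructurable.of_derivationPair`): the remaining
operators are `V_{x,y} = T_{T_v(x)} - [T_v, T_x]` with `T_a = V_{a,1}` and `y = 2 v̄ - v`, where every
`y` is of this form because `3` is invertible. For these special operators the claim has only four
arguments and follows from the two adjoint identities (`isDerivationPair_structurableV_one`).

Finally `K = F ⊕ F ε` with `ε` invertible and `ε^σ = -ε`. Commutators with the skew element `(ε, 0)`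
separate the components of `K ⊕ J`, which gives the assertions on the centre and on the ideals.
-/

/-! ### Quadratic étale algebras -/

/-- A quadratic étale algebra is `F ⊕ F ε` with `ε` skew and invertible. Completing the square gives
`ε² = d ∈ F`, and `d ≠ 0` because étale algebras are reduced. -/
theorem exists_skew_generator {F K : Type*} [Field F] (h2 : (2 : F) ≠ 0)
    [CommRing K] [Algebra F K] [Algebra.Etale F K] (hK : Module.finrank F K = 2)
    (σ : K ≃ₐ[F] K) (hσ : σ ≠ AlgEquiv.refl) :
    ∃ ε : K, σ ε = -ε ∧ IsUnit ε ∧ ∀ x : K, ∃ p q : F, x = algebraMap F K p + q • ε := by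
  have : Nontrivial K := Module.nontrivial_of_finrank_pos (R := F) (by omega)
  have hred : IsReduced K := Algebra.FormallyUnramified.isReduced_of_field F K
  have hinj : Function.Injective (algebraMap F K) := (algebraMap F K).injective
  obtain ⟨x, hx⟩ : ∃ x, σ x ≠ x := by
    by_contra! h
    exact hσ (AlgEquiv.ext h)
  -- `x` is not fixed by `σ`, hence not a multiple of `1`
  have hlin : LinearIndependent F ![(1 : K), x] := by
    rw [LinearIndependent.pair_iff]
    intro s t hst
    have hst' := congrArg σ hst
    simp only [map_add, map_smul, map_one, map_zero] at hst'
    have ht : t • (σ x - x) = 0 := by rw [smul_sub]; linear_combination hst' - hst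
    have ht0 : t = 0 := (smul_eq_zero.1 ht).resolve_right (sub_ne_zero.2 hx)
    subst ht0
    simpa using hst
  have hspan : ∀ y : K, ∃ p q : F, y = p • (1 : K) + q • x := by
    intro y
    have h := hlin.span_eq_top_of_card_eq_finrank (by simp [hK])
    have hy : y ∈ Submodule.span F (Set.range ![(1 : K), x]) := h ▸ Submodule.mem_top
    simp only [Matrix.range_cons, Matrix.range_empty, Set.union_empty, Set.singleton_union] at hy
    obtain ⟨p, q, h⟩ := Submodule.mem_span_pair.1 hy
    exact ⟨p, q, h.symm⟩
  obtain ⟨p, q, hpq⟩ := hspan (x * x)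
  -- completing the square
  set ε : K := x - (q / 2) • (1 : K) with hε
  have hspan' : ∀ y : K, ∃ p q : F, y = algebraMap F K p + q • ε := by
    intro y
    obtain ⟨a, b, rfl⟩ := hspan y
    refine ⟨a + b * (q / 2), b, ?_⟩
    rw [hε, Algebra.algebraMap_eq_smul_one]
    module
  have hsq : ε * ε = algebraMap F K (p + q ^ 2 / 4) := by
    have e : ε * ε = x * x - q • x + (q / 2 * (q / 2)) • (1 : K) := by
      have hq : algebraMap F K q = 2 * algebraMap F K (q / 2) := by
        rw [← map_ofNat (algebraMap F K) 2, ← map_mul, mul_div_cancel₀ q h2]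
      rw [hε]
      simp only [Algebra.smul_def, map_mul]
      rw [hq]
      ring
    rw [e, hpq, Algebra.algebraMap_eq_smul_one]
    have : (p + q ^ 2 / 4) = p + (q / 2 * (q / 2)) := by
      have h4 : (4 : F) ≠ 0 := by
        rw [show (4 : F) = 2 * 2 by norm_num]; exact mul_ne_zero h2 h2
      field_simp; ring
    rw [this]
    module
  set d := p + q ^ 2 / 4
  have hσε : σ ε ≠ ε := by
    rw [hε]; simpa using hx
  have hε0 : ε ≠ 0 := by
    intro h; rw [h] at hσε; simp at hσε
  have hd : d ≠ 0 := by
    intro h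
    rw [h, map_zero] at hsq
    exact hε0 (pow_eq_zero_iff two_ne_zero |>.1 (by rw [pow_two, hsq]))
  have hunit : IsUnit ε := by
    refine IsUnit.of_mul_eq_one (algebraMap F K d⁻¹ * ε) ?_
    rw [mul_left_comm, hsq, ← map_mul, inv_mul_cancel₀ hd, map_one]
  have hind : ∀ a b : F, algebraMap F K a + b • ε = 0 → b = 0 := by
    intro a b h
    have h' : algebraMap F K a + b • σ ε = 0 := by
      have := congrArg σ h
      simpa using this
    have : b • (σ ε - ε) = 0 := by rw [smul_sub]; linear_combination h' - h
    exact (smul_eq_zero.1 this).resolve_right (sub_ne_zero.2 hσε)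
  refine ⟨ε, ?_, hunit, hspan'⟩
  -- write `σ ε = u + v ε`; comparing the squares gives `u = 0` and `v² = 1`
  obtain ⟨u, v, huv⟩ := hspan' (σ ε)
  have h1 : algebraMap F K (u ^ 2 + v ^ 2 * d - d) + (2 * u * v) • ε = 0 := by
    have h := congrArg σ hsq
    rw [map_mul, AlgEquiv.commutes, huv] at h
    simp only [Algebra.smul_def, map_add, map_sub, map_mul, map_pow, map_ofNat] at h ⊢
    linear_combination h - (algebraMap F K v) ^ 2 * hsq
  have h3 := hind _ _ h1
  have h4 : u ^ 2 + v ^ 2 * d - d = 0 := by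
    rw [h3, zero_smul, add_zero] at h1
    exact hinj (by rw [h1, map_zero])
  have hv : v ≠ 0 := by
    rintro rfl
    have : σ (ε - algebraMap F K u) = 0 := by
      rw [map_sub, huv, AlgEquiv.commutes]; simp
    have h0 : ε = algebraMap F K u :=
      sub_eq_zero.1 ((map_eq_zero_iff σ σ.injective).1 this)
    rw [h0] at hσε
    exact hσε (AlgEquiv.commutes _ _)
  have hu : u = 0 := by
    simpa [h2, hv] using h3
  subst hu
  have hv2 : (v - 1) * (v + 1) = 0 := by
    have : ((v - 1) * (v + 1)) * d = 0 := by linear_combination h4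
    exact (mul_eq_zero.1 this).resolve_right hd
  rcases mul_eq_zero.1 hv2 with h | h
  · rw [sub_eq_zero.1 h] at huv
    exact absurd (by simpa using huv) hσε
  · rw [eq_neg_of_add_eq_zero_left h] at huv
    simpa using huv

/-! ### Identities in cubic norm structures -/

namespace CubicNormStructure

variable {K J : Type*} [CommRing K] [AddCommGroup J] [Module K J] (𝒥 : CubicNormStructure K J)

lemma cross_comm (a b : J) : 𝒥.cross a b = 𝒥.cross b a := by
  rw [cross, cross, add_comm a b]; abel

lemma cross_add_left (a b c : J) : 𝒥.cross (a + b) c = 𝒥.cross a c + 𝒥.cross b c := by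
  simp [cross_eq_polarBilin]

lemma cross_add_right (a b c : J) : 𝒥.cross a (b + c) = 𝒥.cross a b + 𝒥.cross a c := by
  simp [cross_eq_polarBilin]

lemma cross_neg_right (a b : J) : 𝒥.cross a (-b) = -𝒥.cross a b := by
  simp [cross_eq_polarBilin]

lemma cross_sub_left (a b c : J) : 𝒥.cross (a - b) c = 𝒥.cross a c - 𝒥.cross b c := by
  simp [cross_eq_polarBilin]

lemma cross_sub_right (a b c : J) : 𝒥.cross a (b - c) = 𝒥.cross a b - 𝒥.cross a c := by
  simp [cross_eq_polarBilin]

lemma sharp_add (a b : J) :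
    𝒥.sharp (a + b) = 𝒥.sharp a + 𝒥.sharp b + 𝒥.cross a b := by
  rw [cross]; abel

lemma sharp_smul (t : K) (a : J) : 𝒥.sharp (t • a) = t ^ 2 • 𝒥.sharp a := by
  rw [QuadraticMap.map_smul, pow_two]

lemma N_neg (a : J) : 𝒥.N (-a) = -𝒥.N a := by
  have h := 𝒥.N_smul (-1) a
  rw [neg_one_smul] at h
  rw [h]; ring

lemma cross_one_left (b : J) : 𝒥.cross 𝒥.one b = 𝒥.T b 𝒥.one • 𝒥.one - b := by
  have h := 𝒥.eq_trace_smul_one_sub b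
  change b = _ - 𝒥.cross 𝒥.one b at h
  exact eq_sub_of_add_eq (by nth_rw 2 [h]; abel)

/-- Compare `N(2 a) = 8 N(a)` with the expansion of `N(a + a)`. -/
lemma T_sharp_self (h2 : IsUnit (2 : K)) (a : J) : 𝒥.T a (𝒥.sharp a) = 3 * 𝒥.N a := by
  have h := 𝒥.N_add a a
  rw [← two_smul K a, N_smul] at h
  exact h2.mul_left_cancel (by linear_combination -h)

/-- The norm of `a` annihilates every scalar annihilating `a`, since `T(a, a^♯) = 3 N(a)`. -/
lemma mul_N_eq_zero {𝒥 : CubicNormStructure K J} (h2 : IsUnit (2 : K)) (h3 : IsUnit (3 : K))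
    {t : K} {a : J} (h : t • a = 0) :
    t * 𝒥.N a = 0 := by
  have h' := 𝒥.T_sharp_self h2 a
  have h0 : 𝒥.T (t • a) (𝒥.sharp a) = 0 := by rw [h]; simp
  rw [map_smul, LinearMap.smul_apply, smul_eq_mul, h', mul_left_comm] at h0
  exact h3.mul_right_eq_zero.1 h0

/-- `T(a × b, c)` is the full linearization of the norm, hence symmetric in its arguments. -/
lemma T_cross_rotate (a b c : J) : 𝒥.T (𝒥.cross a b) c = 𝒥.T (𝒥.cross b c) a := by
  have h := congrArg 𝒥.N (add_assoc a b c)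
  simp only [N_add, sharp_add, map_add, LinearMap.add_apply] at h
  rw [T_symm _ (𝒥.cross a b), T_symm _ (𝒥.cross b c)]
  linear_combination h

/-- The linearization of the adjoint identity `a^♯♯ = N(a) a` in degree `(2, 2)`. The parts of even
and of odd degree in `b` are separated by the substitution `b ↦ -b`. -/
lemma sharp_cross (h2 : IsUnit (2 : K)) (a b : J) :
    𝒥.sharp (𝒥.cross a b) + 𝒥.cross (𝒥.sharp a) (𝒥.sharp b) =
      𝒥.T b (𝒥.sharp a) • b + 𝒥.T a (𝒥.sharp b) • a := by
  have h := 𝒥.sharp_sharp (a + b)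
  have h' := 𝒥.sharp_sharp (a + -b)
  simp only [sharp_add, N_add, cross_add_left, cross_neg_right,
    QuadraticMap.map_neg, map_neg, LinearMap.neg_apply, N_neg, sharp_sharp] at h h'
  refine h2.smul_left_cancel.1 ?_
  linear_combination (norm := module) h + h'

/-- The full linearization of the adjoint identity `a^♯♯ = N(a) a`. -/
lemma cross_cross_sum (h2 : IsUnit (2 : K)) (a b c d : J) :
    𝒥.cross (𝒥.cross a b) (𝒥.cross c d) + 𝒥.cross (𝒥.cross a c) (𝒥.cross b d) +
      𝒥.cross (𝒥.cross a d) (𝒥.cross b c) =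
    𝒥.T (𝒥.cross a b) c • d + 𝒥.T (𝒥.cross a b) d • c + 𝒥.T (𝒥.cross a c) d • b +
      𝒥.T (𝒥.cross b c) d • a := by
  have key : ∀ a b c : J, 𝒥.cross (𝒥.cross a b) (𝒥.cross a c) +
      𝒥.cross (𝒥.sharp a) (𝒥.cross b c) =
      𝒥.T b (𝒥.sharp a) • c + 𝒥.T c (𝒥.sharp a) • b + 𝒥.T a (𝒥.cross b c) • a := by
    intro a b c
    have h := 𝒥.sharp_cross h2 a (b + c)
    have hb := 𝒥.sharp_cross h2 a b
    have hc := 𝒥.sharp_cross h2 a c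
    simp only [sharp_add, cross_add_right, map_add, LinearMap.add_apply] at h
    linear_combination (norm := module) h - hb - hc
  have h := key (a + d) b c
  have ha := key a b c
  have hd := key d b c
  simp only [sharp_add, cross_add_right, cross_add_left, map_add, LinearMap.add_apply] at h
  rw [𝒥.cross_comm c d, 𝒥.cross_comm b d, 𝒥.cross_comm (𝒥.cross a c)]
  have e1 : 𝒥.T (𝒥.cross a b) d = 𝒥.T b (𝒥.cross a d) := by
    rw [𝒥.cross_comm a b, T_cross_rotate, T_symm]
  have e2 : 𝒥.T (𝒥.cross a c) d = 𝒥.T c (𝒥.cross a d) := by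
    rw [𝒥.cross_comm a c, T_cross_rotate, T_symm]
  have e3 : 𝒥.T (𝒥.cross a b) c = 𝒥.T a (𝒥.cross b c) := by
    rw [T_cross_rotate, T_symm]
  rw [e1, e2, e3, T_symm _ (𝒥.cross b c) d]
  linear_combination (norm := module) h - ha - hd

/-- The case `d = 1` of `cross_cross_sum`. -/
lemma cross_cross_cyclic_sum (h2 : IsUnit (2 : K)) (a b c : J) :
    𝒥.cross (𝒥.cross a b) c + 𝒥.cross (𝒥.cross b c) a + 𝒥.cross (𝒥.cross c a) b =
      (𝒥.T c 𝒥.one * 𝒥.T (𝒥.cross a b) 𝒥.one + 𝒥.T a 𝒥.one * 𝒥.T (𝒥.cross b c) 𝒥.one +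
        𝒥.T b 𝒥.one * 𝒥.T (𝒥.cross c a) 𝒥.one - 𝒥.T (𝒥.cross a b) c) • 𝒥.one
      - 𝒥.T c 𝒥.one • 𝒥.cross a b - 𝒥.T a 𝒥.one • 𝒥.cross b c - 𝒥.T b 𝒥.one • 𝒥.cross c a
      - 𝒥.T (𝒥.cross a b) 𝒥.one • c - 𝒥.T (𝒥.cross b c) 𝒥.one • a
      - 𝒥.T (𝒥.cross c a) 𝒥.one • b := by
  have h := 𝒥.cross_cross_sum h2 a b c 𝒥.one
  rw [𝒥.cross_comm a 𝒥.one, 𝒥.cross_comm b 𝒥.one, 𝒥.cross_comm c 𝒥.one,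
    𝒥.cross_comm (𝒥.cross 𝒥.one a), 𝒥.cross_comm a c] at h
  simp only [cross_one_left, cross_sub_right, cross_smul_right, 𝒥.cross_comm _ 𝒥.one] at h
  linear_combination (norm := module) -h

lemma T_cross_one (a b : J) :
    𝒥.T (𝒥.cross a b) 𝒥.one = 𝒥.T a 𝒥.one * 𝒥.T b 𝒥.one - 𝒥.T a b := by
  rw [← T_cross_rotate, cross_one_left, map_sub, LinearMap.sub_apply, map_smul,
    LinearMap.smul_apply, smul_eq_mul, 𝒥.T_symm 𝒥.one b]

/-- The full linearization of the second adjoint identity `a × (a^♯ × b) = N(a) b + T(a, b) a^♯`.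
It is reduced to `cross_cross_sum` by means of `cross_cross_cyclic_sum`; as `T` may be degenerate,
it cannot be obtained by duality. -/
lemma cross_cross_cross_sum (h2 : IsUnit (2 : K)) (a b c d : J) :
    𝒥.cross a (𝒥.cross (𝒥.cross b c) d) + 𝒥.cross b (𝒥.cross (𝒥.cross c a) d) +
      𝒥.cross c (𝒥.cross (𝒥.cross a b) d) =
    𝒥.T (𝒥.cross a b) c • d + 𝒥.T a d • 𝒥.cross b c + 𝒥.T b d • 𝒥.cross c a +
      𝒥.T c d • 𝒥.cross a b := by
  have h := 𝒥.cross_cross_cyclic_sum h2 a b c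
  have h' := congrArg (fun x => 𝒥.cross x d) h
  have h4 := 𝒥.cross_cross_sum h2 a b c d
  rw [𝒥.cross_comm a c] at h4
  have ht := congrArg (fun x => 𝒥.T x 𝒥.one) h4
  have ha := 𝒥.cross_cross_cyclic_sum h2 a (𝒥.cross b c) d
  have hb := 𝒥.cross_cross_cyclic_sum h2 b (𝒥.cross c a) d
  have hc := 𝒥.cross_cross_cyclic_sum h2 c (𝒥.cross a b) d
  simp only [cross_add_left, cross_sub_left, cross_smul_left, cross_one_left] at h'
  simp only [map_add, map_smul, LinearMap.add_apply, LinearMap.smul_apply, smul_eq_mul] at ht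
  have s1 : 𝒥.T a (𝒥.cross b c) = 𝒥.T (𝒥.cross a b) c := by
    rw [T_symm, 𝒥.T_cross_rotate a b c]
  have s2 : 𝒥.T b (𝒥.cross c a) = 𝒥.T (𝒥.cross a b) c := by
    rw [T_symm, ← 𝒥.T_cross_rotate c a b]
  have u (x y : J) : 𝒥.T (𝒥.cross x y) d = 𝒥.T (𝒥.cross d x) y := by
    rw [← T_cross_rotate]
  simp only [T_cross_one, u a (𝒥.cross b c), u b (𝒥.cross c a), u c (𝒥.cross a b), s1, s2,
    𝒥.T_symm c (𝒥.cross a b), 𝒥.cross_comm d, 𝒥.T_symm d, 𝒥.T_symm (𝒥.cross a b) (𝒥.cross c d),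
    𝒥.T_symm (𝒥.cross c a) (𝒥.cross b d)] at h h' ht ha hb hc
  rw [𝒥.cross_comm a (𝒥.cross (𝒥.cross b c) d), 𝒥.cross_comm b (𝒥.cross (𝒥.cross c a) d),
    𝒥.cross_comm c (𝒥.cross (𝒥.cross a b) d)]
  rw [𝒥.cross_comm a (𝒥.cross b c)] at ha
  rw [𝒥.cross_comm b (𝒥.cross c a), 𝒥.cross_comm (𝒥.cross b d)] at hb
  rw [𝒥.cross_comm c (𝒥.cross a b), 𝒥.cross_comm (𝒥.cross c d)] at hc
  -- the terms `(a × (b × c)) × d` in `ha + hb + hc` cancel against `h'`, the terms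
  -- `(b × c) × a` against `h`, and the multiples of `1` against `ht`
  linear_combination (norm := module) ha + hb + hc - h' - h4 - 𝒥.T 𝒥.one d • h
    + congrArg (· • 𝒥.one) ht

end CubicNormStructure

/-! ### Self-adjoint autotopies -/

namespace CubicNormStructure.Autotopy

variable {K J : Type*} [CommRing K] [AddCommGroup J] [Module K J] {𝒥 : CubicNormStructure K J}
  {σ : K ≃+* K} {φ : 𝒥.Autotopy σ}

lemma map_sharp (φ : 𝒥.Autotopy σ) (a : J) :
    φ (𝒥.sharp a) = Ring.inverse (𝒥.N (φ 𝒥.one)) • 𝒥.U (φ 𝒥.one) (𝒥.sharp (φ a)) :=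
  φ.map_sharp' a

lemma isUnit_N_map_one (φ : 𝒥.Autotopy σ) : IsUnit (𝒥.N (φ 𝒥.one)) := φ.isInvertible_map_one'

lemma injective (φ : 𝒥.Autotopy σ) : Function.Injective φ := φ.toAddEquiv.injective

lemma surjective (φ : 𝒥.Autotopy σ) : Function.Surjective φ := φ.toAddEquiv.surjective

lemma IsSelfAdjoint.map_map (hφ : φ.IsSelfAdjoint) (a : J) : φ (φ a) = 𝒥.U (φ 𝒥.one) a := by
  have h : φ.toAddEquiv.symm (𝒥.U (φ 𝒥.one) a) = φ a := congrFun hφ a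
  rw [← h]
  exact φ.toAddEquiv.apply_symm_apply _

/-- The autotopy law, after cancelling one `φ` by means of `φ² = U_z`. -/
lemma IsSelfAdjoint.map_sharp_map_of_conj (hφ : φ.IsSelfAdjoint) (hσ : ∀ t, σ (σ t) = t) (a : J) :
    φ (𝒥.sharp (φ a)) = σ (𝒥.N (φ 𝒥.one)) • 𝒥.sharp a := by
  apply φ.injective
  rw [φ.map_smul, hσ, φ.map_sharp a, smul_smul, Ring.mul_inverse_cancel _ φ.isUnit_N_map_one,
    one_smul, hφ.map_map]

/-- In general only `N(1) 1 = 1` holds. An autotopy makes this a statement about `φ(1)`, whose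
annihilator vanishes because its norm is invertible. -/
lemma N_one (φ : 𝒥.Autotopy σ) (h2 : IsUnit (2 : K)) (h3 : IsUnit (3 : K)) : 𝒥.N 𝒥.one = 1 := by
  have h := 𝒥.sharp_sharp 𝒥.one
  rw [𝒥.sharp_one, 𝒥.sharp_one] at h
  have h' : (σ (𝒥.N 𝒥.one) - 1) • φ 𝒥.one = 0 := by
    rw [sub_smul, one_smul, ← φ.map_smul, ← h, sub_self]
  have h0 := φ.isUnit_N_map_one.mul_left_eq_zero.1 (mul_N_eq_zero (𝒥 := 𝒥) h2 h3 h')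
  exact σ.injective (by rw [map_one]; exact sub_eq_zero.1 h0)

/-- Obtained by iterating the map `a ↦ φ(a)^♯`, whose square is `a ↦ (δ^σ)² N(a) a` for
`δ = N(φ(1))`. -/
lemma IsSelfAdjoint.N_map_smul (hφ : φ.IsSelfAdjoint) (hσ : ∀ t, σ (σ t) = t) (a : J) :
    (𝒥.N (φ 𝒥.one) ^ 2 * σ (𝒥.N a)) • φ a =
      (σ (𝒥.N (φ 𝒥.one)) * 𝒥.N (φ a)) • φ a := by
  have h1 := hφ.map_sharp_map_of_conj hσ (𝒥.sharp (φ a))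
  have h2 := congrArg 𝒥.sharp (hφ.map_sharp_map_of_conj hσ a)
  rw [𝒥.sharp_smul, 𝒥.sharp_sharp, smul_smul] at h2
  rw [h2, 𝒥.sharp_sharp, φ.map_smul, map_mul, map_pow, hσ, smul_smul] at h1
  exact h1

lemma IsSelfAdjoint.map_N_map_one (hφ : φ.IsSelfAdjoint) (hσ : ∀ t, σ (σ t) = t)
    (h2 : IsUnit (2 : K)) (h3 : IsUnit (3 : K)) : σ (𝒥.N (φ 𝒥.one)) = 𝒥.N (φ 𝒥.one) := by
  have h := hφ.N_map_smul hσ 𝒥.one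
  rw [φ.N_one h2 h3, map_one, mul_one, ← sub_eq_zero, ← sub_smul] at h
  have h' := φ.isUnit_N_map_one.mul_left_eq_zero.1 (mul_N_eq_zero h2 h3 h)
  exact φ.isUnit_N_map_one.mul_left_cancel (by linear_combination -h')

lemma IsSelfAdjoint.map_sharp_map (hφ : φ.IsSelfAdjoint) (hσ : ∀ t, σ (σ t) = t)
    (h2 : IsUnit (2 : K)) (h3 : IsUnit (3 : K)) (a : J) :
    φ (𝒥.sharp (φ a)) = 𝒥.N (φ 𝒥.one) • 𝒥.sharp a := by
  rw [hφ.map_sharp_map_of_conj hσ, hφ.map_N_map_one hσ h2 h3]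

lemma IsSelfAdjoint.map_cross_map (hφ : φ.IsSelfAdjoint) (hσ : ∀ t, σ (σ t) = t)
    (h2 : IsUnit (2 : K)) (h3 : IsUnit (3 : K)) (a b : J) :
    φ (𝒥.cross (φ a) (φ b)) = 𝒥.N (φ 𝒥.one) • 𝒥.cross a b := by
  have h := hφ.map_sharp_map hσ h2 h3 (a + b)
  simp only [φ.map_add, sharp_add, smul_add] at h
  rw [hφ.map_sharp_map hσ h2 h3, hφ.map_sharp_map hσ h2 h3] at h
  exact add_left_cancel h

/-- A self-adjoint autotopy multiplies the norm by `N(φ(1))`, up to `σ`. Both sides agree after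
multiplication by `φ(a)`; hence their difference is nilpotent. -/
lemma IsSelfAdjoint.N_map [IsReduced K] (hφ : φ.IsSelfAdjoint) (hσ : ∀ t, σ (σ t) = t)
    (h2 : IsUnit (2 : K)) (h3 : IsUnit (3 : K)) (a : J) :
    𝒥.N (φ a) = 𝒥.N (φ 𝒥.one) * σ (𝒥.N a) := by
  set δ := 𝒥.N (φ 𝒥.one) with hδ
  have hδσ : σ δ = δ := hφ.map_N_map_one hσ h2 h3
  have hu : IsUnit δ := φ.isUnit_N_map_one
  set D := 𝒥.N (φ a) - δ * σ (𝒥.N a) with hD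
  have h : (δ * D) • φ a = 0 := by
    have := hφ.N_map_smul hσ a
    rw [← hδ, hδσ] at this
    rw [hD]
    linear_combination (norm := module) -this
  have h1 : D * 𝒥.N (φ a) = 0 := by
    have := mul_N_eq_zero (𝒥 := 𝒥) h2 h3 h
    rw [mul_assoc] at this
    exact hu.mul_right_eq_zero.1 this
  have h4 : D * σ (𝒥.N a) = 0 := by
    have h' : σ (δ * D) • a = 0 := by
      apply φ.injective
      rw [φ.map_smul, hσ, h, φ.map_zero]
    have := congrArg σ (mul_N_eq_zero (𝒥 := 𝒥) h2 h3 h')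
    rw [map_mul, hσ, _root_.map_zero, mul_assoc] at this
    exact hu.mul_right_eq_zero.1 this
  have h5 : D ^ 2 = 0 := by
    have : D ^ 2 = D * 𝒥.N (φ a) - δ * (D * σ (𝒥.N a)) := by rw [hD]; ring
    rw [this, h1, h4]; ring
  exact sub_eq_zero.1 (pow_eq_zero_iff two_ne_zero |>.1 h5)

lemma IsSelfAdjoint.T_map_sharp [IsReduced K] (hφ : φ.IsSelfAdjoint) (hσ : ∀ t, σ (σ t) = t)
    (h2 : IsUnit (2 : K)) (h3 : IsUnit (3 : K)) (a b : J) :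
    𝒥.T (φ b) (𝒥.sharp (φ a)) = 𝒥.N (φ 𝒥.one) * σ (𝒥.T b (𝒥.sharp a)) := by
  have h := hφ.N_map hσ h2 h3 (a + b)
  have h' := hφ.N_map hσ h2 h3 (a + -b)
  have hn : φ (-b) = -φ b := map_neg φ.toAddEquiv b
  simp only [φ.map_add, hn, N_add, _root_.map_add, map_neg, LinearMap.neg_apply, N_neg,
    QuadraticMap.map_neg] at h h'
  rw [hφ.N_map hσ h2 h3 a, hφ.N_map hσ h2 h3 b] at h h'
  exact h2.mul_left_cancel (by linear_combination h - h')

/-- The hermitian symmetry of `(a, b) ↦ T(a, φ(b))`. It suffices to consider `b = (φ c)^♯`, as the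
elements `c^♯` span `J`. -/
lemma IsSelfAdjoint.T_map [IsReduced K] (hφ : φ.IsSelfAdjoint) (hσ : ∀ t, σ (σ t) = t)
    (h2 : IsUnit (2 : K)) (h3 : IsUnit (3 : K)) (a b : J) :
    𝒥.T a (φ b) = σ (𝒥.T b (φ a)) := by
  have hδσ := hφ.map_N_map_one hσ h2 h3
  have key : ∀ c, 𝒥.T a (φ (𝒥.sharp c)) = σ (𝒥.T (𝒥.sharp c) (φ a)) := by
    intro c
    obtain ⟨c, rfl⟩ := φ.surjective c
    rw [hφ.map_sharp_map hσ h2 h3, 𝒥.T_symm (𝒥.sharp _), hφ.T_map_sharp hσ h2 h3, map_mul, hσ,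
      hδσ, _root_.map_smul, smul_eq_mul]
  have hb : b = 𝒥.T b 𝒥.one • 𝒥.sharp 𝒥.one -
      (𝒥.sharp (𝒥.one + b) - 𝒥.sharp 𝒥.one - 𝒥.sharp b) := by
    rw [𝒥.sharp_one]
    have := 𝒥.cross_one_left b
    rw [cross, 𝒥.sharp_one] at this
    rw [this]; abel
  have hs (x y : J) : φ (x - y) = φ x - φ y := map_sub φ.toAddEquiv x y
  rw [hb]
  simp only [hs, φ.map_smul, map_sub, LinearMap.sub_apply, _root_.map_smul, LinearMap.smul_apply,
    smul_eq_mul, map_mul, key]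

end CubicNormStructure.Autotopy

/-! ### Hermitian cubic products -/

/-- The laws satisfied by the form `h(a, b) = T(a, φ(b))` and the product
`a ∗ b = γ (φ(a) × φ(b))` on `J`: the form is hermitian, the product is commutative and
`σ`-semilinear in both arguments, `h(a ∗ b, c)` is symmetric, and the two adjoint identities hold
in fully linearized form. -/
structure IsHermitianCubic {K J : Type*} [CommRing K] [AddCommGroup J] [Module K J]
    (σ : K ≃+* K) (h : J → J → K) (star : J → J → J) : Prop where
  h_add_left : ∀ a b c, h (a + b) c = h a c + h b c
  h_smul_left : ∀ (t : K) a b, h (t • a) b = t * h a b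
  h_conj : ∀ a b, σ (h a b) = h b a
  star_add_left : ∀ a b c, star (a + b) c = star a c + star b c
  star_smul_left : ∀ (t : K) a b, star (t • a) b = σ t • star a b
  star_comm : ∀ a b, star a b = star b a
  h_star_rotate : ∀ a b c, h (star a b) c = h (star b c) a
  star_star_sum : ∀ a b c d,
    star (star a b) (star c d) + star (star a c) (star b d) + star (star a d) (star b c) =
      h a (star b c) • d + h a (star b d) • c + h a (star c d) • b + h b (star c d) • a
  star_star_star_sum : ∀ a b c d,
    star a (star (star b c) d) + star b (star (star c a) d) + star c (star (star a b) d) =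
      h (star a b) c • d + h d a • star b c + h d b • star c a + h d c • star a b

namespace IsHermitianCubic

variable {K J : Type*} [CommRing K] [AddCommGroup J] [Module K J] {σ : K ≃+* K}
  {h : J → J → K} {star : J → J → J} (H : IsHermitianCubic σ h star)

include H

lemma h_add_right (a b c : J) : h a (b + c) = h a b + h a c := by
  rw [← H.h_conj, H.h_add_left, map_add, H.h_conj, H.h_conj]

lemma h_smul_right (t : K) (a b : J) : h a (t • b) = σ t * h a b := by
  rw [← H.h_conj, H.h_smul_left, map_mul, H.h_conj]

lemma h_neg_left (a b : J) : h (-a) b = -h a b := by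
  rw [← neg_one_smul K a, H.h_smul_left, neg_one_mul]

lemma h_sub_left (a b c : J) : h (a - b) c = h a c - h b c := by
  rw [sub_eq_add_neg, H.h_add_left, H.h_neg_left, sub_eq_add_neg]

lemma h_sub_right (a b c : J) : h a (b - c) = h a b - h a c := by
  rw [← H.h_conj, H.h_sub_left, map_sub, H.h_conj, H.h_conj]

lemma star_add_right (a b c : J) : star a (b + c) = star a b + star a c := by
  rw [H.star_comm, H.star_add_left, H.star_comm b, H.star_comm c]

lemma star_smul_right (t : K) (a b : J) : star a (t • b) = σ t • star a b := by
  rw [H.star_comm, H.star_smul_left, H.star_comm]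

lemma star_neg_left (a b : J) : star (-a) b = -star a b := by
  rw [← neg_one_smul K a, H.star_smul_left, map_neg, map_one, neg_one_smul]

lemma star_sub_left (a b c : J) : star (a - b) c = star a c - star b c := by
  rw [sub_eq_add_neg, H.star_add_left, H.star_neg_left, sub_eq_add_neg]

lemma star_sub_right (a b c : J) : star a (b - c) = star a b - star a c := by
  rw [H.star_comm, H.star_sub_left, H.star_comm b, H.star_comm c]

lemma h_zero_right (a : J) : h a 0 = 0 := by
  rw [← zero_smul K (0 : J), H.h_smul_right, map_zero, zero_mul]

lemma h_zero_left (a : J) : h 0 a = 0 := by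
  rw [← H.h_conj, H.h_zero_right, map_zero]

lemma star_zero_right (a : J) : star a 0 = 0 := by
  rw [← zero_smul K (0 : J), H.star_smul_right, map_zero, zero_smul, zero_smul]

lemma h_star_swap (a b c : J) : h (star a b) c = h (star a c) b := by
  rw [H.star_comm, H.h_star_rotate]

lemma h_star_right_swap (a b c : J) : h a (star b c) = h b (star a c) := by
  rw [← H.h_conj, ← H.h_star_rotate, H.h_star_swap, H.h_conj]

end IsHermitianCubic

namespace CubicNormStructure.Autotopy

variable {K J : Type*} [CommRing K] [AddCommGroup J] [Module K J] {𝒥 : CubicNormStructure K J}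
  {σ : K ≃+* K}

/-- The form `h(a, b) = T(a, φ(b))`. -/
def herm (φ : 𝒥.Autotopy σ) (a b : J) : K := 𝒥.T a (φ b)

/-- The product `a ∗ b = γ (φ(a) × φ(b))`. -/
def star (φ : 𝒥.Autotopy σ) (γ : K) (a b : J) : J := γ • 𝒥.cross (φ a) (φ b)

variable {φ : 𝒥.Autotopy σ}

/-- The identities of `𝒥` are carried over by `φ(φ(a) × φ(b)) = δ (a × b)` and `γ γ^σ δ = 1`, where
`δ = N(φ(1))`. -/
lemma IsSelfAdjoint.isHermitianCubic [IsReduced K] (hφ : φ.IsSelfAdjoint)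
    (hσ : ∀ t, σ (σ t) = t) (h2 : IsUnit (2 : K)) (h3 : IsUnit (3 : K)) {γ : K}
    (hγ : γ * σ γ = Ring.inverse (𝒥.N (φ 𝒥.one))) :
    IsHermitianCubic σ φ.herm (φ.star γ) := by
  have hγδ : γ * σ γ * 𝒥.N (φ 𝒥.one) = 1 := by
    rw [hγ, Ring.inverse_mul_cancel _ φ.isUnit_N_map_one]
  have hmap : ∀ a b, φ (φ.star γ a b) = (σ γ * 𝒥.N (φ 𝒥.one)) • 𝒥.cross a b := fun a b => by
    rw [star, φ.map_smul, hφ.map_cross_map hσ h2 h3, smul_smul]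
  have hconj : ∀ a b, σ (φ.herm a b) = φ.herm b a := fun a b => by
    rw [herm, ← hφ.T_map hσ h2 h3, herm]
  have hrot : ∀ a b c, φ.herm (φ.star γ a b) c = φ.herm (φ.star γ b c) a := fun a b c => by
    simp only [herm, star, _root_.map_smul, LinearMap.smul_apply, 𝒥.T_cross_rotate (φ a)]
  have hright : ∀ a b c, φ.herm a (φ.star γ b c) =
      (σ γ * 𝒥.N (φ 𝒥.one)) * 𝒥.T (𝒥.cross b c) a := fun a b c => by
    rw [herm, hmap, _root_.map_smul, smul_eq_mul, 𝒥.T_symm]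
  refine ⟨?_, ?_, hconj, ?_, ?_, ?_, hrot, ?_, ?_⟩
  · intro a b c
    simp [herm]
  · intro t a b
    simp [herm]
  · intro a b c
    simp only [star, φ.map_add, cross_add_left, smul_add]
  · intro t a b
    rw [star, φ.map_smul, cross_smul_left, smul_comm, star]
  · intro a b
    rw [star, star, 𝒥.cross_comm]
  · intro a b c d
    have hss : ∀ a b c d, φ.star γ (φ.star γ a b) (φ.star γ c d) =
        (σ γ * 𝒥.N (φ 𝒥.one)) • 𝒥.cross (𝒥.cross a b) (𝒥.cross c d) := fun a b c d => by
      rw [star, hmap, hmap, cross_smul_left, cross_smul_right, smul_smul, smul_smul]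
      congr 1
      linear_combination (σ γ * 𝒥.N (φ 𝒥.one)) * hγδ
    have hr : ∀ a b c, 𝒥.T (𝒥.cross b c) a = 𝒥.T (𝒥.cross a b) c := fun a b c =>
      (𝒥.T_cross_rotate a b c).symm
    rw [hss, hss, hss, hright, hright, hright, hright, hr a b c, hr a b d, hr a c d,
      hr b c d]
    have h := 𝒥.cross_cross_sum h2 a b c d
    linear_combination (norm := module) (σ γ * 𝒥.N (φ 𝒥.one)) • h
  · intro a b c d
    have hss : ∀ a b c d, φ.star γ a (φ.star γ (φ.star γ b c) d) =
        γ • 𝒥.cross (φ a) (𝒥.cross (𝒥.cross (φ b) (φ c)) d) := fun a b c d => by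
      rw [star, hmap, star, cross_smul_left, smul_smul]
      congr 2
      rw [show σ γ * 𝒥.N (φ 𝒥.one) * γ = 1 by linear_combination hγδ, one_smul]
    rw [hss, hss, hss]
    have h := 𝒥.cross_cross_cross_sum h2 (φ a) (φ b) (φ c) d
    simp only [herm, star, _root_.map_smul, LinearMap.smul_apply, smul_eq_mul, 𝒥.T_symm d]
    linear_combination (norm := module) γ • h

end CubicNormStructure.Autotopy

/-! ### Structurability from derivations -/

section

variable {F A : Type*} [Field F] [NonAssocRing A] [Module F A] [SMulCommClass F A A]
  [IsScalarTower F A A] {bar : A →ₗ[F] A}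

lemma structurableV_apply (bar : A →ₗ[F] A) (x y z : A) :
    structurableV bar x y z = (x * bar y) * z + (z * bar y) * x - (z * bar x) * y := rfl

lemma structurableV_add_left (bar : A →ₗ[F] A) (x x' y : A) :
    structurableV bar (x + x') y = structurableV bar x y + structurableV bar x' y := by
  ext z
  simp only [structurableV_apply, LinearMap.add_apply, map_add, add_mul, mul_add]
  abel

lemma structurableV_add_right (bar : A →ₗ[F] A) (x y y' : A) :
    structurableV bar x (y + y') = structurableV bar x y + structurableV bar x y' := by
  ext z
  simp only [structurableV_apply, LinearMap.add_apply, map_add, add_mul, mul_add]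
  abel

lemma structurableV_neg_left (bar : A →ₗ[F] A) (x y : A) :
    structurableV bar (-x) y = -structurableV bar x y :=
  eq_neg_of_add_eq_zero_left <| by
    rw [← structurableV_add_left, neg_add_cancel]
    ext z
    simp [structurableV_apply]

lemma structurableV_neg_right (bar : A →ₗ[F] A) (x y : A) :
    structurableV bar x (-y) = -structurableV bar x y :=
  eq_neg_of_add_eq_zero_left <| by
    rw [← structurableV_add_right, neg_add_cancel]
    ext z
    simp [structurableV_apply]

lemma structurableV_sub_left (bar : A →ₗ[F] A) (x x' y : A) :
    structurableV bar (x - x') y = structurableV bar x y - structurableV bar x' y := by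
  rw [sub_eq_add_neg, structurableV_add_left, structurableV_neg_left, sub_eq_add_neg]

lemma structurableV_sub_right (bar : A →ₗ[F] A) (x y y' : A) :
    structurableV bar x (y - y') = structurableV bar x y - structurableV bar x y' := by
  rw [sub_eq_add_neg, structurableV_add_right, structurableV_neg_right, sub_eq_add_neg]

/-- `(D, D')` is a derivation pair of the triple product `{x, y, z} = V_{x,y}(z)` if
`D {x, y, z} = {D x, y, z} + {x, D' y, z} + {x, y, D z}`. -/
def IsDerivationPair (bar : A →ₗ[F] A) (D D' : Module.End F A) : Prop :=
  ∀ x y z, D (structurableV bar x y z) = structurableV bar (D x) y z +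
    structurableV bar x (D' y) z + structurableV bar x y (D z)

namespace IsDerivationPair

variable {D D' E E' : Module.End F A}

lemma sub (hD : IsDerivationPair bar D D') (hE : IsDerivationPair bar E E') :
    IsDerivationPair bar (D - E) (D' - E') := fun x y z => by
  simp only [LinearMap.sub_apply, structurableV_sub_left, structurableV_sub_right, hD x y z,
    hE x y z, map_sub]
  abel

lemma lie (hD : IsDerivationPair bar D D') (hE : IsDerivationPair bar E E') :
    IsDerivationPair bar ⁅D, E⁆ ⁅D', E'⁆ := fun x y z => by
  simp only [Ring.lie_def, LinearMap.sub_apply, Module.End.mul_apply, structurableV_sub_left,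
    structurableV_sub_right, map_sub, hE x y z, hD x y z, map_add, hD _ _ _, hE _ _ _]
  abel

end IsDerivationPair

/-- If `V_{a,1}` and `-V_{ā,1}` form a derivation pair of the triple product for every `a`, then so
do `V_{x,y}` and `-V_{y,x}` for all `x` and `y`. Indeed, with `T_a = V_{a,1}` and `y = 2 v̄ - v`,
`V_{x,y} = T_b - [T_v, T_x]` for `b = T_v(x)`, while `-V_{y,x}` is the expression obtained from this
one when every `T_a` is replaced by `-T_ā`. -/
lemma IsStructurable.of_derivationPair (h3 : (3 : F) ≠ 0) (bar_one : bar 1 = 1)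
    (bar_bar : ∀ x, bar (bar x) = x) (bar_mul : ∀ x y, bar (x * y) = bar y * bar x)
    (hder : ∀ a, IsDerivationPair bar (structurableV bar a 1) (-structurableV bar (bar a) 1)) :
    IsStructurable bar := by
  have hone : ∀ z, structurableV bar (bar z) 1 1 = bar z + bar z - z := fun z => by
    simp only [structurableV_apply, bar_bar, bar_one, mul_one, one_mul]
  have hone' : ∀ z, structurableV bar 1 z = structurableV bar (bar z) 1 := fun z => by
    ext u
    simp only [structurableV_apply, bar_bar, bar_one, mul_one, one_mul]
  refine ⟨bar_bar, bar_mul, fun x y z w => ?_⟩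
  obtain ⟨v, rfl⟩ : ∃ v, y = bar v + bar v - v := by
    refine ⟨(3 : F)⁻¹ • (bar y + bar y + y), ?_⟩
    simp only [map_smul, map_add, bar_bar]
    match_scalars <;> field_simp <;> ring
  have hV : structurableV bar x (bar v + bar v - v) =
      structurableV bar (structurableV bar v 1 x) 1 -
        ⁅structurableV bar v 1, structurableV bar x 1⁆ := by
    ext u
    have h := hder v x 1 u
    rw [LinearMap.neg_apply, hone, structurableV_neg_right] at h
    simp only [Ring.lie_def, LinearMap.sub_apply, LinearMap.neg_apply, Module.End.mul_apply] at h ⊢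
    rw [h]
    abel
  have hV' : -structurableV bar (bar v + bar v - v) x =
      -structurableV bar (bar (structurableV bar v 1 x)) 1 -
        ⁅-structurableV bar (bar v) 1, -structurableV bar (bar x) 1⁆ := by
    ext u
    have h := hder (bar v) 1 x u
    rw [hone, LinearMap.neg_apply, structurableV_neg_right, bar_bar, hone', hone'] at h
    simp only [Ring.lie_def, LinearMap.sub_apply, LinearMap.neg_apply, Module.End.mul_apply,
      map_neg, neg_neg] at h ⊢
    rw [h]
    abel
  have h : IsDerivationPair bar (structurableV bar x (bar v + bar v - v))
      (-structurableV bar (bar v + bar v - v) x) := by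
    rw [hV, hV']
    exact (hder _).sub ((hder v).lie (hder x))
  ext u
  have hu := h z w u
  rw [LinearMap.neg_apply, structurableV_neg_right, LinearMap.neg_apply] at hu
  rw [Ring.lie_def, LinearMap.sub_apply, Module.End.mul_apply, Module.End.mul_apply,
    LinearMap.sub_apply, hu]
  abel

end

/-! ### The triple product -/

namespace AutotopyAlgebra

variable {F K J : Type*} [Field F] [CommRing K] [Algebra F K] [AddCommGroup J] [Module K J]
  {𝒥 : CubicNormStructure K J} {σ : K ≃ₐ[F] K} {φ : 𝒥.Autotopy σ.toRingEquiv} {γ : K}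

lemma fst_sub (x y : AutotopyAlgebra φ γ) : (x - y).fst = x.fst - y.fst := rfl

lemma snd_sub (x y : AutotopyAlgebra φ γ) : (x - y).snd = x.snd - y.snd := rfl

lemma fst_mul_eq (x y : AutotopyAlgebra φ γ) :
    (x * y).fst = x.fst * y.fst + φ.herm x.snd y.snd := rfl

lemma snd_mul_eq (x y : AutotopyAlgebra φ γ) :
    (x * y).snd = x.fst • y.snd + σ y.fst • x.snd + φ.star γ x.snd y.snd := rfl

variable [Module F J]

lemma fst_bar (x : AutotopyAlgebra φ γ) : (bar φ γ x).fst = σ x.fst := rfl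

lemma snd_bar (x : AutotopyAlgebra φ γ) : (bar φ γ x).snd = x.snd := rfl

variable (H : IsHermitianCubic σ.toRingEquiv φ.herm (φ.star γ)) (hσ : ∀ t, σ (σ t) = t)

include H hσ

lemma bar_mul (x y : AutotopyAlgebra φ γ) :
    bar φ γ (x * y) = bar φ γ y * bar φ γ x := by
  have hc : ∀ a b, σ (φ.herm a b) = φ.herm b a := H.h_conj
  apply AutotopyAlgebra.ext
  · simp only [fst_bar, fst_mul_eq, snd_bar, map_add, map_mul, hc]
    ring
  · simp only [snd_bar, snd_mul_eq, fst_bar, hσ, H.star_comm y.snd]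
    module

omit H hσ

variable [IsScalarTower F K J]

include H hσ

lemma fst_structurableV (x y z : AutotopyAlgebra φ γ) :
    (structurableV (bar φ γ) x y z).fst =
      (2 * x.fst * σ y.fst - σ x.fst * y.fst) * z.fst + x.fst * φ.herm y.snd z.snd +
        y.fst * φ.herm x.snd z.snd + z.fst * φ.herm y.snd x.snd +
        φ.herm (φ.star γ x.snd y.snd) z.snd := by
  have e1 : φ.herm (φ.star γ z.snd y.snd) x.snd = φ.herm (φ.star γ x.snd y.snd) z.snd := by
    rw [H.star_comm x.snd, H.h_star_rotate z.snd]
  have e2 : φ.herm (φ.star γ z.snd x.snd) y.snd = φ.herm (φ.star γ x.snd y.snd) z.snd := by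
    rw [H.h_star_rotate z.snd]
  simp only [structurableV_apply, fst_sub, fst_add, fst_mul_eq, snd_mul_eq, fst_bar, snd_bar,
    H.h_add_left, H.h_smul_left, hσ, e1, e2]
  ring

lemma snd_structurableV (x y z : AutotopyAlgebra φ γ) :
    (structurableV (bar φ γ) x y z).snd =
      (φ.herm x.snd y.snd + σ x.fst * y.fst) • z.snd +
        (x.fst * σ z.fst - φ.herm z.snd x.snd) • y.snd +
        (σ z.fst * y.fst + φ.herm z.snd y.snd) • x.snd + σ z.fst • φ.star γ x.snd y.snd +
        σ x.fst • φ.star γ y.snd z.snd + σ y.fst • φ.star γ x.snd z.snd +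
        φ.star γ (φ.star γ x.snd y.snd) z.snd + φ.star γ (φ.star γ y.snd z.snd) x.snd -
        φ.star γ (φ.star γ z.snd x.snd) y.snd := by
  have hs : ∀ (t : K) a b, φ.star γ (t • a) b = σ t • φ.star γ a b := H.star_smul_left
  simp only [structurableV_apply, snd_sub, snd_add, fst_mul_eq, snd_mul_eq, fst_bar, snd_bar,
    H.star_add_left, hs, hσ, H.star_comm z.snd y.snd, H.star_comm z.snd x.snd,
    H.star_comm y.snd x.snd]
  module

/-- The operator `T_a = V_{a,1}` is `(r, c) ↦ ((2s - s^σ) r + h(b, c), s^σ c + r^σ b + b ∗ c)` for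
`a = (s, b)`. For `b = 0` the derivation property compares the weights of the terms of the triple
product; for `s = 0` it amounts to the two adjoint identities. -/
lemma isDerivationPair_structurableV_one (a : AutotopyAlgebra φ γ) :
    IsDerivationPair (bar φ γ) (structurableV (bar φ γ) a 1)
      (-structurableV (bar φ γ) (bar φ γ a) 1) := by
  intro x y z
  rw [LinearMap.neg_apply, structurableV_neg_right, LinearMap.neg_apply, ← sub_eq_add_neg]
  have T1 (a x : AutotopyAlgebra φ γ) : (structurableV (bar φ γ) a 1 x).fst =
      (2 * a.fst - σ a.fst) * x.fst + φ.herm a.snd x.snd := by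
    rw [fst_structurableV H hσ, fst_one, snd_one, map_one, H.star_zero_right]
    simp only [H.h_zero_left]
    ring
  have T2 (a x : AutotopyAlgebra φ γ) : (structurableV (bar φ γ) a 1 x).snd =
      σ a.fst • x.snd + σ x.fst • a.snd + φ.star γ a.snd x.snd := by
    have hz (a : J) : φ.star γ 0 a = 0 := by rw [H.star_comm, H.star_zero_right]
    rw [snd_structurableV H hσ, fst_one, snd_one, map_one]
    simp only [H.h_zero_right, H.star_zero_right, hz]
    module
  have hs : ∀ (t : K) a b, φ.star γ (t • a) b = σ t • φ.star γ a b := H.star_smul_left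
  have hs' : ∀ (t : K) a b, φ.star γ a (t • b) = σ t • φ.star γ a b := H.star_smul_right
  have hh' : ∀ (t : K) a b, φ.herm a (t • b) = σ t * φ.herm a b := H.h_smul_right
  have hc : ∀ a b, σ (φ.herm a b) = φ.herm b a := H.h_conj
  -- the pairings of an element with an iterated product, in terms of the pairings of products
  have p1 : ∀ u v w t, φ.herm (φ.star γ (φ.star γ u v) w) t =
      φ.herm (φ.star γ w t) (φ.star γ u v) := fun u v w t => H.h_star_rotate _ _ _
  have p2 : ∀ u v w t, φ.herm t (φ.star γ (φ.star γ u v) w) =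
      φ.herm (φ.star γ u v) (φ.star γ w t) := fun u v w t => by
    rw [H.h_star_right_swap, H.star_comm t]
  apply AutotopyAlgebra.ext
  · simp only [fst_sub, fst_add, T1, T2, fst_structurableV H hσ, snd_structurableV H hσ, fst_bar,
      snd_bar, H.h_add_left, H.h_smul_left, H.h_add_right, hh', H.h_sub_right, hσ, hc, map_add,
      map_sub, map_mul, map_ofNat, H.star_add_left, hs, H.star_add_right, hs', p1, p2]
    generalize a.snd = A, x.snd = X, y.snd = Y, z.snd = Z, a.fst = a, x.fst = x, y.fst = y,
      z.fst = z
    -- by the symmetry of `h (a ∗ b, c)`, only one pairing of each kind remains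
    have q1 := H.h_star_swap A Y X
    have q2 := H.h_star_rotate A X Y
    have q3 := H.h_star_right_swap Y A X
    have q4 := H.h_star_right_swap X A Z
    have q5 := H.h_star_right_swap Y A Z
    rw [H.star_comm Y X] at q3
    have q6 := (H.h_star_rotate Z X (φ.star γ A Y)).symm
    simp only [H.star_comm X A, H.star_comm Y A, H.star_comm Z A, H.star_comm Z X,
      q1, ← q2, q3, q4, q5, q6]
    ring
  · simp only [snd_sub, snd_add, T1, T2, fst_structurableV H hσ, snd_structurableV H hσ, fst_bar,
      snd_bar, H.h_add_left, H.h_smul_left, H.h_add_right, hh', hσ, hc, map_add,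
      map_sub, map_mul, map_ofNat, H.star_add_left, H.star_add_right, hs, hs', H.star_sub_right]
    generalize a.snd = A, x.snd = X, y.snd = Y, z.snd = Z, a.fst = a, x.fst = x, y.fst = y,
      z.fst = z
    -- `r1` collects the terms of the form `(a ∗ b) ∗ (c ∗ d)`; the terms `a ∗ ((b ∗ c) ∗ d)` are
    -- collected by `r2`, `r3`, `r4` according to the factor `d`, in which they are linear
    have r1 := H.star_star_sum A X Y Z
    have r2 := H.star_star_star_sum A X Y Z
    have r3 := H.star_star_star_sum A Y Z X
    have r4 := H.star_star_star_sum A X Z Y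
    simp only [H.h_star_swap A Z X, H.h_star_swap A Z Y, H.h_star_right_swap X A,
      H.h_star_right_swap Z A, H.h_star_right_swap Z X Y, H.star_comm Z Y]
    simp only [H.star_comm] at r1 r2 r3 r4 ⊢
    linear_combination (norm := module) r2 + r3 - r4 - r1

end AutotopyAlgebra

/-! ### Centrality and simplicity -/

namespace AutotopyAlgebra

variable {F K J : Type*} [Field F] [CommRing K] [Algebra F K] [AddCommGroup J] [Module K J]
  {𝒥 : CubicNormStructure K J} {σ : K ≃ₐ[F] K} {φ : 𝒥.Autotopy σ.toRingEquiv} {γ : K}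

lemma mk_zero_mul (t : K) (x : AutotopyAlgebra φ γ) :
    (⟨t, 0⟩ : AutotopyAlgebra φ γ) * x = ⟨t * x.fst, t • x.snd⟩ := by
  apply AutotopyAlgebra.ext <;>
  simp [fst_mul, snd_mul, φ.map_zero, CubicNormStructure.cross_eq_polarBilin]

lemma mul_mk_zero (t : K) (x : AutotopyAlgebra φ γ) :
    x * (⟨t, 0⟩ : AutotopyAlgebra φ γ) = ⟨x.fst * t, σ t • x.snd⟩ := by
  apply AutotopyAlgebra.ext <;>
  simp [fst_mul, snd_mul, φ.map_zero, CubicNormStructure.cross_eq_polarBilin]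

variable [Module F J] {ε : K}

lemma eq_algebraMap_of_map_eq (h2 : (2 : F) ≠ 0) (hε : σ ε = -ε)
    (hspan : ∀ x : K, ∃ p q : F, x = algebraMap F K p + q • ε) {s : K} (hs : σ s = s) :
    ∃ p : F, s = algebraMap F K p := by
  obtain ⟨p, q, rfl⟩ := hspan s
  refine ⟨p, ?_⟩
  simp only [map_add, AlgEquiv.commutes, map_smul, hε, smul_neg, add_right_inj] at hs
  have h : (2 * q) • ε = 0 := by rw [two_mul, add_smul]; nth_rw 1 [← hs]; simp
  rw [mul_smul] at h
  rw [(smul_eq_zero.1 h).resolve_left h2, add_zero]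

lemma finrank_skewElements [Nontrivial K] [IsScalarTower F K J] (h2 : (2 : F) ≠ 0)
    (hε : σ ε = -ε) (hεu : IsUnit ε) (hspan : ∀ x : K, ∃ p q : F, x = algebraMap F K p + q • ε) :
    Module.finrank F (skewElements (bar φ γ)) = 1 := by
  refine finrank_eq_one ⟨⟨ε, 0⟩, ?_⟩ ?_ ?_
  · exact AutotopyAlgebra.ext hε neg_zero.symm
  · intro h
    exact hεu.ne_zero (congrArg (fun x => x.1.fst) h)
  · rintro ⟨x, hx⟩
    have hx' : bar φ γ x = -x := hx
    have hf : σ x.fst = -x.fst := congrArg fst hx'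
    have hg : x.snd = -x.snd := congrArg snd hx'
    have hg0 : x.snd = 0 := by
      have h : (2 : F) • x.snd = 0 := by rw [two_smul]; nth_rw 1 [hg]; simp
      exact (smul_eq_zero.1 h).resolve_left h2
    obtain ⟨p, q, hpq⟩ := hspan x.fst
    have hp : p = 0 := by
      rw [hpq] at hf
      simp only [map_add, AlgEquiv.commutes, map_smul, hε, smul_neg, neg_add, add_left_inj] at hf
      have h : algebraMap F K (2 * p) = 0 := by
        rw [two_mul, map_add]; nth_rw 1 [hf]; simp
      have h' : 2 * p = 0 := (algebraMap F K).injective (by rw [h, map_zero])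
      exact (mul_eq_zero.1 h').resolve_left h2
    refine ⟨q, Subtype.ext (AutotopyAlgebra.ext ?_ ?_)⟩
    · change q • ε = x.fst
      rw [hpq, hp, map_zero, zero_add]
    · change q • (0 : J) = x.snd
      rw [hg0, smul_zero]

/-- The centre is determined by commutation with the skew element `(ε, 0)`. -/
lemma isCentralWithInvolution_bar [IsScalarTower F K J] (h2 : (2 : F) ≠ 0)
    (hε : σ ε = -ε) (hεu : IsUnit ε) (hspan : ∀ x : K, ∃ p q : F, x = algebraMap F K p + q • ε) :
    IsCentralWithInvolution (bar φ γ) := by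
  apply Set.Subset.antisymm
  · rintro x ⟨hx, hc, -⟩
    have hf : σ x.fst = x.fst := congrArg fst hx
    obtain ⟨p, hp⟩ := eq_algebraMap_of_map_eq h2 hε hspan hf
    have h := hc ⟨ε, 0⟩
    rw [mul_mk_zero, mk_zero_mul, hε] at h
    have h' : -ε • x.snd - ε • x.snd = 0 := congrArg snd h
    have hg : x.snd = 0 := by
      rw [← hεu.smul_eq_zero]
      have h3 : (2 : F) • ε • x.snd = 0 := by
        rw [two_smul]; linear_combination (norm := module) -h'
      exact (smul_eq_zero.1 h3).resolve_left h2
    refine ⟨p, AutotopyAlgebra.ext ?_ ?_⟩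
    · change p • (1 : K) = x.fst
      rw [hp, Algebra.algebraMap_eq_smul_one]
    · change p • (0 : J) = x.snd
      rw [hg, smul_zero]
  · rintro _ ⟨r, rfl⟩
    refine ⟨?_, ?_, ?_, ?_, ?_⟩
    · rw [map_smul]
      exact congrArg (r • ·) (AutotopyAlgebra.ext (map_one σ) rfl)
    · simp
    · simp [associator_apply, smul_mul_assoc]
    · simp [associator_apply, smul_mul_assoc, mul_smul_comm]
    · simp [associator_apply, mul_smul_comm]

/-- An ideal contains the components of each of its elements. It contains `1` unless all its
elements have vanishing `K`-component, and in that case these lie in the radical of `T`. -/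
lemma isSimpleWithInvolution_bar [Nontrivial K] [IsScalarTower F K J] (h2 : (2 : F) ≠ 0)
    (hε : σ ε = -ε) (hεu : IsUnit ε) (hspan : ∀ x : K, ∃ p q : F, x = algebraMap F K p + q • ε)
    (hT : 𝒥.T.Nondegenerate) : IsSimpleWithInvolution (bar φ γ) := by
  refine ⟨⟨0, 1, fun h => zero_ne_one (congrArg fst h)⟩, ?_⟩
  rintro I ⟨hr, hl, hbar⟩
  obtain ⟨η, hη⟩ := hεu.exists_left_inv
  have hsnd : ∀ x ∈ I, (⟨0, x.snd⟩ : AutotopyAlgebra φ γ) ∈ I := by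
    intro x hx
    -- the commutator of `(ε, 0)` and `x` is `(0, 2 ε b)`
    have h := I.smul_mem (2 : F)⁻¹ (hl _ (I.sub_mem (hl x hx ⟨ε, 0⟩) (hr x hx ⟨ε, 0⟩)) ⟨η, 0⟩)
    rw [mul_mk_zero, mk_zero_mul, mk_zero_mul, hε] at h
    convert h using 1
    apply AutotopyAlgebra.ext
    · change 0 = (2 : F)⁻¹ • (η * (ε * x.fst - x.fst * ε))
      rw [mul_comm ε, sub_self, mul_zero, smul_zero]
    · change x.snd = (2 : F)⁻¹ • η • (ε • x.snd - -ε • x.snd)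
      rw [neg_smul, sub_neg_eq_add, smul_add, smul_smul, hη, one_smul, ← two_smul F, smul_smul,
        inv_mul_cancel₀ h2, one_smul]
  have hfst : ∀ x ∈ I, (⟨x.fst, 0⟩ : AutotopyAlgebra φ γ) ∈ I := by
    intro x hx
    convert I.sub_mem hx (hsnd x hx) using 1
    exact AutotopyAlgebra.ext (sub_zero _).symm (sub_self _).symm
  by_cases h0 : ∀ x ∈ I, x.fst = 0
  · left
    rw [Submodule.eq_bot_iff]
    intro x hx
    refine AutotopyAlgebra.ext (h0 x hx) ?_
    apply hT.1
    intro c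
    obtain ⟨c, rfl⟩ := φ.surjective c
    have h := h0 _ (hr x hx ⟨0, c⟩)
    rw [fst_mul, mul_zero, zero_add] at h
    exact h
  · right
    push Not at h0
    obtain ⟨x, hx, hx0⟩ := h0
    obtain ⟨r, hr1, hr0⟩ : ∃ r : F, r ≠ 0 ∧ (⟨algebraMap F K r, 0⟩ : AutotopyAlgebra φ γ) ∈ I := by
      obtain ⟨p, q, hpq⟩ := hspan x.fst
      have hfx := hfst x hx
      have hb : bar φ γ ⟨x.fst, 0⟩ ∈ I := hbar ▸ Submodule.mem_map_of_mem hfx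
      by_cases hp : p = 0
      · -- here `x.fst = q ε` is invertible
        have hq : q ≠ 0 := by
          rintro rfl
          exact hx0 (by rw [hpq, hp]; simp)
        refine ⟨q, hq, ?_⟩
        convert hl _ hfx ⟨η, 0⟩ using 1
        rw [mk_zero_mul, hpq, hp]
        refine AutotopyAlgebra.ext ?_ (smul_zero _).symm
        simp [hη, Algebra.algebraMap_eq_smul_one]
      · refine ⟨2 * p, mul_ne_zero h2 hp, ?_⟩
        convert I.add_mem hfx hb using 1
        refine AutotopyAlgebra.ext ?_ (add_zero _).symm
        change _ = x.fst + σ x.fst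
        rw [hpq, map_add, AlgEquiv.commutes, map_smul, hε, map_mul, map_ofNat, smul_neg]
        ring
    have h1 : (1 : AutotopyAlgebra φ γ) ∈ I := by
      convert I.smul_mem r⁻¹ hr0 using 1
      refine AutotopyAlgebra.ext ?_ (smul_zero _).symm
      change (1 : K) = r⁻¹ • algebraMap F K r
      rw [Algebra.algebraMap_eq_smul_one, smul_smul, inv_mul_cancel₀ hr1, one_smul]
    rw [Submodule.eq_top_iff']
    intro y
    simpa using hr 1 h1 y

end AutotopyAlgebra

theorem mainTheorem1 {F K J : Type*} [Field F] (h2 : (2 : F) ≠ 0) (h3 : (3 : F) ≠ 0)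
    [CommRing K] [Algebra F K] [Algebra.Etale F K] (hK : Module.finrank F K = 2)
    (σ : K ≃ₐ[F] K) (hσ : σ ≠ AlgEquiv.refl)
    [AddCommGroup J] [Module K J] [Module F J] [IsScalarTower F K J]
    (𝒥 : CubicNormStructure K J) (φ : 𝒥.Autotopy σ.toRingEquiv) (hφ : φ.IsSelfAdjoint)
    (γ : K) (hγ : γ * σ γ = Ring.inverse (𝒥.N (φ 𝒥.one))) :
    𝒥.N (φ 𝒥.one) ∈ Set.range (algebraMap F K) ∧
    IsStructurable (AutotopyAlgebra.bar φ γ) ∧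
    Module.finrank F (skewElements (AutotopyAlgebra.bar φ γ)) = 1 ∧
    (𝒥.T.Nondegenerate →
      IsCentralWithInvolution (AutotopyAlgebra.bar φ γ) ∧
      IsSimpleWithInvolution (AutotopyAlgebra.bar φ γ)) := by
  have : Nontrivial K := Module.nontrivial_of_finrank_pos (R := F) (by omega)
  have : IsReduced K := Algebra.FormallyUnramified.isReduced_of_field F K
  obtain ⟨ε, hε, hεu, hspan⟩ := exists_skew_generator h2 hK σ hσ
  have hσσ : ∀ t, σ (σ t) = t := fun t => by
    obtain ⟨p, q, rfl⟩ := hspan t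
    simp [hε]
  have hu2 : IsUnit (2 : K) := by
    have h := (IsUnit.mk0 _ h2).map (algebraMap F K)
    rwa [map_ofNat] at h
  have hu3 : IsUnit (3 : K) := by
    have h := (IsUnit.mk0 _ h3).map (algebraMap F K)
    rwa [map_ofNat] at h
  have H := hφ.isHermitianCubic hσσ hu2 hu3 hγ
  obtain ⟨p, hp⟩ := AutotopyAlgebra.eq_algebraMap_of_map_eq h2 hε hspan
    (hφ.map_N_map_one hσσ hu2 hu3)
  refine ⟨⟨p, hp.symm⟩, ?_, AutotopyAlgebra.finrank_skewElements h2 hε hεu hspan, fun hT =>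
    ⟨AutotopyAlgebra.isCentralWithInvolution_bar h2 hε hεu hspan,
      AutotopyAlgebra.isSimpleWithInvolution_bar h2 hε hεu hspan hT⟩⟩
  exact IsStructurable.of_derivationPair h3 (AutotopyAlgebra.ext (map_one σ) rfl)
    (fun x => AutotopyAlgebra.ext (hσσ x.fst) rfl) (AutotopyAlgebra.bar_mul H hσσ)
    (AutotopyAlgebra.isDerivationPair_structurableV_one H hσσ)
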